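/- **Runs and games.** There are two players, the machine $\top$ and the environment $\bot$; $\neg\wp$ is the adversary of $\wp$. Variables are $v_0,v_1,v_2,\dots$, constants are $0,1,2,\dots$ (identified with their decimal numerals when used as moves), and a term is a variable or a constant. A valuation $e$ is a function from variables to constants, extended to terms by $e(c)=c$. A move is a finite string over the keyboard alphabet plus the symbol $\spadesuit$; a labmove is a move labeled by a player; a run is a finite or infinite sequence of labmoves, and a position is a finite run. A game $A$ assigns to each valuation $e$ a set $\mathbf{Lr}^A_e$ of (legal) runs and to each $e$ and run $\Gamma$ a winner $\mathbf{Wn}^A_e\langle\Gamma\rangle\in\{\top,\bot\}$, such that (a) a run is legal iff all its nonempty finite initial segments are legal; (b) no legal run contains the move $\spadesuit$; (c) if the shortest illegal initial segment of $\Gamma$ ends with a move of $\wp$, then $\mathbf{Wn}^A_e\langle\Gamma\rangle=\neg\wp$. $A$ is elementary if the empty run is its only legal run; $A$ depends on $x$ if two valuations differing at most at $x$ give different legal runs or different winners. $A[x_1/t_1,\dots,x_n/t_n]$ is $A$ evaluated at the valuation that sends $x_i$ to $e(t_i)$ and agrees with $e$ elsewhere. **Operations** (winners are given for legal runs; for illegal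 runs they are fixed by (c)). $\neg A$ switches the roles of the players. The legal runs of $A_1\wedge\dots\wedge A_n$ are those whose every move has a prefix "$i.$" with $1\le i\le n$ and whose $i$-th component $\Gamma^{i.}$ (the moves with prefix "$i.$", with the prefix deleted) is legal for $A_i$, for each $i$; $\top$ wins iff it wins all components. The legal runs of $A_1\sqcap\dots\sqcap A_n$ are the empty run and $\langle\bot i,\Delta\rangle$ with $1\le i\le n$ and $\Delta$ legal for $A_i$; $\bot$ wins iff the run is such a $\langle\bot i,\Delta\rangle$ with $\Delta$ won by $\bot$ in $A_i$. $\sqcap xA$ is defined likewise, with a choice among the games $A[x/c]$, $c$ a constant, by the move $c$. $\forall xA$ has the legal runs of $A$, and $\top$ wins iff it wins $A[x/c]$ for every constant $c$. $\vee,\sqcup,\sqcup x,\exists x$ are the De Morgan duals, $A\to B$ is $\neg A\vee B$, and $\top,\bot$ also denote the elementary games always won by that player. **Formulas.** Formulas are built from $\top$, $\bot$ and atoms $p(t_1,\dots,t_n)$ ($p$ an $n$-ary predicate letter, $t_i$ terms) by $\neg$, $\to$, $n$-ary $\wedge,\vee,\sqcap,\sqcup$ ($n\ge2$), and the quantifiers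 $\forall x,\exists x,\sqcap x,\sqcup x$. An interpretation $^*$ sends each $n$-ary predicate letter $p$ to an elementary game $p^*=A(x_1,\dots,x_n)$ with an attached tuple of distinct variables; it extends to formulas by $p(t_1,\dots,t_n)^*=A[x_1/t_1,\dots,x_n/t_n]$ and by commuting with all operations. It is $F$-admissible if, for every predicate letter $p$, $p^*$ depends on no variable that occurs in $F$ and is not in the tuple attached to $p$. **Machines.** A hard-play machine (HPM) is a Turing machine with a read-only valuation tape (listing $e(v_0),e(v_1),\dots$), a read-only run tape (spelling the current position, initially empty), a read/write work tape (initially empty), and some states designated as move states. In each clock cycle it performs one transition; if it is in a move state, it makes the move $\alpha$ written at the beginning of its work tape. If in that cycle the environment makes the (finitely many, arbitrary) moves $\beta_1,\dots,\beta_k$, then $\bot\beta_1,\dots,\bot\beta_k$, followed by $\top\alpha$ if the machine has moved, are appended to the position. An HPM $\mathcal H$ wins a game $A$ if, for every valuation $e$ and all behaviors of the environment, the run $\Gamma$ generated in the whole (infinite) computation satisfies $\mathbf{Wn}^A_e\langle\Gamma\rangle=\top$. A formula $F$ is *valid* if for every $F$-admissible interpretation $^*$ there is an HPM that wins $F^*$;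 it is *uniformly valid* if there is one HPM that wins $F^*$ for every $F$-admissible interpretation $^*$. **Theorem.** A formula is valid if and only if it is uniformly valid. -/

import Mathlib

namespace CoL

/-! ### Variables, constants, moves, runs -/

/-- The variables `v₀, v₁, v₂, …`, represented by their indices. -/
abbrev Var := ℕ

/-- A valuation sends every variable to a constant; the constants are `0, 1, 2, …`. -/
abbrev Valuation := Var → ℕ

inductive Term where
  | var (x : Var)
  | const (c : ℕ)

/-- Valuations extend to terms, with `e(c) = c` for constants. -/
def Term.eval (e : Valuation) : Term → ℕ
  | .var x => e x
  | .const c => c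

/-- The standard keyboard alphabet (the 95 printable characters: ten digits, the period and 84
others) together with the symbol `♠`. -/
inductive Key where
  | digit (d : Fin 10)
  | dot
  | other (i : Fin 84)
  | spade
  deriving DecidableEq

abbrev Move := List Key

/-- `top` is the machine, `bot` is the environment. -/
inductive Player where
  | top
  | bot
  deriving DecidableEq

def Player.neg : Player → Player
  | .top => .bot
  | .bot => .top

abbrev LabMove := Player × Move

abbrev Position := List LabMove

/-- Finite or infinite sequences of labmoves. -/
abbrev Run := Stream'.Seq LabMove

/-- A position regarded as a run. -/
abbrev Position.toRun (Φ : Position) : Run := Stream'.Seq.ofList Φ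

/-- `Φ` is a finite initial segment of `Γ`. -/
def IsInit (Φ : Position) (Γ : Run) : Prop :=
  ∀ n m, Φ[n]? = some m → Γ.get? n = some m

/-- The decimal numeral of `c`, most significant digit first. -/
def decimalDigits (c : ℕ) : List (Fin 10) :=
  if c = 0 then [0] else (Nat.digits 10 c).reverse.map (Fin.ofNat 10)

/-- The decimal numeral of `c` as a string of keyboard symbols. -/
def decimal (c : ℕ) : Move := (decimalDigits c).map Key.digit

theorem decimalDigits_val (c : ℕ) :
    Nat.ofDigits 10 ((decimalDigits c).map Fin.val).reverse = c := by
  unfold decimalDigits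
  split_ifs with h
  · subst h; simp
  · rw [List.map_map, ← List.map_reverse, List.reverse_reverse]
    have : (Nat.digits 10 c).map (Fin.val ∘ Fin.ofNat 10) = Nat.digits 10 c := by
      conv_rhs => rw [← List.map_id (Nat.digits 10 c)]
      apply List.map_congr_left
      intro d hd
      have := Nat.digits_lt_base (by norm_num : 1 < 10) hd
      simp [Fin.ofNat, Nat.mod_eq_of_lt this]
    rw [this, Nat.ofDigits_digits]

theorem decimal_injective : Function.Injective decimal := by
  intro a b h
  have h' : decimalDigits a = decimalDigits b :=
    List.map_injective_iff.2 (fun _ _ h => Key.digit.inj h) h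
  rw [← decimalDigits_val a, h', decimalDigits_val]

theorem decimal_head (c : ℕ) (l : Move) : decimal c ++ l ≠ [Key.spade] := by
  intro h
  have hne : decimalDigits c ≠ [] := by
    unfold decimalDigits
    split_ifs with hc
    · simp
    · simpa using Nat.digits_ne_nil_iff_ne_zero.2 hc
  obtain ⟨d, t, hd⟩ := List.exists_cons_of_ne_nil hne
  simp [decimal, hd] at h

/-- The run incrementally spelled by a growing sequence of positions. -/
noncomputable def Run.limit (s : ℕ → Position) : Run :=
  ⟨fun n => open scoped Classical in
      if h : ∃ m k, (s k)[n]? = some m then some h.choose else none, by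
    intro n hn
    have hn' : ¬ ∃ m k, (s k)[n]? = some m := by
      intro h
      simp [h] at hn
    have : ¬ ∃ m k, (s k)[n + 1]? = some m := by
      rintro ⟨m, k, hk⟩
      obtain ⟨hlt, -⟩ := List.getElem?_eq_some_iff.1 hk
      exact hn' ⟨(s k)[n], k, List.getElem?_eq_getElem (by omega)⟩
    simp [this]⟩

theorem Run.limit_get? {s : ℕ → Position} (hs : ∀ i j, i ≤ j → s i <+: s j) (n : ℕ)
    (m : LabMove) : (Run.limit s).get? n = some m ↔ ∃ k, (s k)[n]? = some m := by
  have key : ∀ k l m m', (s k)[n]? = some m → (s l)[n]? = some m' → m = m' := by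
    intro k l m m' h h'
    have h1 := (List.prefix_iff_getElem?.1 (hs k (max k l) (le_max_left _ _)))
    have h2 := (List.prefix_iff_getElem?.1 (hs l (max k l) (le_max_right _ _)))
    obtain ⟨a, ha⟩ := List.getElem?_eq_some_iff.1 h
    obtain ⟨b, hb⟩ := List.getElem?_eq_some_iff.1 h'
    have e1 := h1 n a
    have e2 := h2 n b
    rw [ha] at e1
    rw [hb] at e2
    exact Option.some.inj (e1.symm.trans e2)
  have hdef : (Run.limit s).get? n = open scoped Classical in
      if h : ∃ m k, (s k)[n]? = some m then some h.choose else none := rfl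
  rw [hdef]
  constructor
  · intro h
    split_ifs at h with hx
    obtain ⟨k, hk⟩ := hx.choose_spec
    exact ⟨k, by rw [hk]; exact h⟩
  · rintro ⟨k, hk⟩
    have hx : ∃ m k, (s k)[n]? = some m := ⟨m, k, hk⟩
    rw [dif_pos hx]
    obtain ⟨l, hl⟩ := hx.choose_spec
    rw [key l k _ _ hl hk]

/-- Switching all labels of a run. -/
def Run.neg (Γ : Run) : Run := Γ.map (fun m => (m.1.neg, m.2))

/-- If the move begins with `γ`, delete this prefix and keep the label. -/
def stripPrefix (γ : Move) (m : LabMove) : Option LabMove :=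
  if γ <+: m.2 then some (m.1, m.2.drop γ.length) else none

/-- `Γ^γ`: keep only the labmoves whose move begins with `γ`, and delete that prefix. -/
noncomputable def Run.proj (γ : Move) (Γ : Run) : Run :=
  Run.limit (fun k => (Γ.take k).filterMap (stripPrefix γ))

/-! ### Games -/

/-- The shortest illegal initial segment of `Γ` ends with a move of the player `p`, where `L` is
the set of legal runs. -/
def IllegalBy (L : Set Run) (p : Player) (Γ : Run) : Prop :=
  ∃ (Φ : Position) (α : Move), IsInit (Φ ++ [(p, α)]) Γ ∧
    Position.toRun (Φ ++ [(p, α)]) ∉ L ∧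
    ∀ Ψ : Position, Ψ <+: Φ → Position.toRun Ψ ∈ L

structure Game where
  legal : Valuation → Set Run
  win : Valuation → Run → Player
  legal_iff : ∀ e Γ, Γ ∈ legal e ↔
    ∀ Φ : Position, Φ ≠ [] → IsInit Φ Γ → Φ.toRun ∈ legal e
  no_spade : ∀ e, ∀ Γ ∈ legal e, ∀ p n, Γ.get? n ≠ some (p, [Key.spade])
  win_illegal : ∀ e Γ p, IllegalBy (legal e) p Γ → win e Γ = p.neg

/-- `A` depends on the variable `x`. -/
def Game.DependsOn (A : Game) (x : Var) : Prop :=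
  ∃ e₁ e₂ : Valuation, (∀ y, y ≠ x → e₁ y = e₂ y) ∧
    (A.legal e₁ ≠ A.legal e₂ ∨ A.win e₁ ≠ A.win e₂)

/-- Elementary games: the empty run is the only legal run. -/
def Game.IsElementary (A : Game) : Prop :=
  ∀ e, ∀ Γ ∈ A.legal e, Γ = Stream'.Seq.nil

theorem IsInit.toRun_iff {Φ Ψ : Position} : IsInit Φ Ψ.toRun ↔ Φ <+: Ψ := by
  rw [List.prefix_iff_getElem?]
  constructor
  · intro h i hi
    have := h i _ (List.getElem?_eq_getElem hi)
    simpa using this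
  · intro h n m hm
    obtain ⟨a, ha⟩ := List.getElem?_eq_some_iff.1 hm
    have := h n a
    rw [ha] at this
    simpa using this

theorem IsInit.comparable {Φ Ψ : Position} {Γ : Run} (h : IsInit Φ Γ) (h' : IsInit Ψ Γ)
    (hl : Φ.length ≤ Ψ.length) : Φ <+: Ψ := by
  rw [List.prefix_iff_getElem?]
  intro i hi
  have h1 := h i _ (List.getElem?_eq_getElem hi)
  have h2 := h' i _ (List.getElem?_eq_getElem (lt_of_lt_of_le hi hl))
  rw [List.getElem?_eq_getElem (lt_of_lt_of_le hi hl), ← h2, h1]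

theorem IllegalBy.unique {L : Set Run} {p q : Player} {Γ : Run}
    (h : IllegalBy L p Γ) (h' : IllegalBy L q Γ) : p = q := by
  obtain ⟨Φ, α, hi, hn, hl⟩ := h
  obtain ⟨Ψ, β, hi', hn', hl'⟩ := h'
  have main : ∀ {Φ Ψ : Position} {m m' : LabMove}, IsInit (Φ ++ [m]) Γ → IsInit (Ψ ++ [m']) Γ →
      Position.toRun (Φ ++ [m]) ∉ L → (∀ Θ : Position, Θ <+: Ψ → Position.toRun Θ ∈ L) →
      ¬ Φ.length < Ψ.length := by
    intro Φ Ψ m m' a b c d hlt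
    have hpre : Φ ++ [m] <+: Ψ ++ [m'] := a.comparable b (by simp; omega)
    have : Φ ++ [m] <+: Ψ :=
      List.prefix_of_prefix_length_le hpre (List.prefix_append _ _) (by simp; omega)
    exact c (d _ this)
  have h1 := main hi hi' hn hl'
  have h2 := main hi' hi hn' hl
  have hlen : Φ.length = Ψ.length := by omega
  have hpre := hi.comparable hi' (by simp [hlen])
  have heq := hpre.eq_of_length (by simp [hlen])
  have := List.append_inj_right heq hlen
  simp at this
  exact this.1

open scoped Classical in
/-- The game with the legal runs `L` whose legal runs have the winner given by `w`; an illegal run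
is lost by the player who made the first illegal move. -/
noncomputable def Game.ofLegal (L : Valuation → Set Run) (w : Valuation → Run → Player)
    (hL : ∀ e Γ, Γ ∈ L e ↔ ∀ Φ : Position, Φ ≠ [] → IsInit Φ Γ → Φ.toRun ∈ L e)
    (hs : ∀ e, ∀ Γ ∈ L e, ∀ p n, Γ.get? n ≠ some (p, [Key.spade])) : Game where
  legal := L
  win e Γ := if Γ ∈ L e then w e Γ else if IllegalBy (L e) .top Γ then .bot else .top
  legal_iff := hL
  no_spade := hs
  win_illegal := by
    intro e Γ p h
    have hΓ : Γ ∉ L e := by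
      obtain ⟨Φ, α, hi, hn, -⟩ := h
      exact fun hΓ => hn ((hL e Γ).1 hΓ _ (by simp) hi)
    rw [if_neg hΓ]
    cases p with
    | top => rw [if_pos h]; rfl
    | bot =>
      rw [if_neg]
      · rfl
      · exact fun h' => by cases h.unique h'

theorem Game.legal_of_init (A : Game) {e : Valuation} {Γ : Run} (h : Γ ∈ A.legal e)
    {Φ : Position} (hi : IsInit Φ Γ) : Φ.toRun ∈ A.legal e := by
  rw [A.legal_iff]
  intro Ψ hne hΨ
  refine (A.legal_iff e Γ).1 h Ψ hne (fun n m hm => hi n m ?_)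
  simpa using hΨ n m hm

/-! ### Operations on games -/

/-- `A[x₁/t₁, …, xₙ/tₙ]`: the game `A` evaluated at the valuation that sends `xᵢ` to `e(tᵢ)` and
agrees with `e` elsewhere (the `xᵢ` are meant to be pairwise distinct). -/
noncomputable def Game.subst (A : Game) {n : ℕ} (xs : Fin n → Var) (ts : Fin n → Term) : Game where
  legal e := A.legal (Function.extend xs (fun i => (ts i).eval e) e)
  win e := A.win (Function.extend xs (fun i => (ts i).eval e) e)
  legal_iff _ := A.legal_iff _
  no_spade _ := A.no_spade _
  win_illegal _ := A.win_illegal _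

/-- `A[x/c]` for a constant `c`. -/
def Game.inst (A : Game) (x : Var) (c : ℕ) : Game where
  legal e := A.legal (Function.update e x c)
  win e := A.win (Function.update e x c)
  legal_iff _ := A.legal_iff _
  no_spade _ := A.no_spade _
  win_illegal _ := A.win_illegal _

/-- The trivial game won by `p`. -/
noncomputable def Game.trivial (p : Player) : Game :=
  Game.ofLegal (fun _ => {Stream'.Seq.nil}) (fun _ _ => p)
    (by
      intro e Γ
      constructor
      · rintro rfl Φ hne hi
        obtain ⟨m, t, rfl⟩ := List.exists_cons_of_ne_nil hne
        have := hi 0 m (by simp)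
        simp at this
      · intro h
        by_contra hΓ
        have h0 : Γ.get? 0 ≠ none := fun h0 => hΓ (Stream'.Seq.get?_zero_eq_none.1 h0)
        obtain ⟨m, hm⟩ := Option.ne_none_iff_exists'.1 h0
        have := h [m] (by simp) (by
          intro n m' hm'
          cases n with
          | zero => simp at hm'; rw [hm, hm']
          | succ n => simp at hm')
        have h2 : (Position.toRun [m]).get? 0 = none := by
          rw [Set.mem_singleton_iff.1 this]; simp
        simp at h2)
    (by
      rintro e Γ rfl p n
      simp)

theorem Run.neg_neg (Γ : Run) : Γ.neg.neg = Γ := by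
  apply Stream'.Seq.ext
  intro n
  unfold Run.neg
  rw [Stream'.Seq.map_get?, Stream'.Seq.map_get?]
  cases Γ.get? n with
  | none => rfl
  | some m => obtain ⟨p, α⟩ := m; cases p <;> rfl

/-- Switching all labels of a position. -/
def Position.neg (Φ : Position) : Position := Φ.map (fun m => (m.1.neg, m.2))

theorem Position.neg_neg (Φ : Position) : Φ.neg.neg = Φ := by
  unfold Position.neg
  rw [List.map_map]
  conv_rhs => rw [← List.map_id Φ]
  apply List.map_congr_left
  rintro ⟨p, α⟩ -
  cases p <;> rfl

theorem Position.toRun_neg (Φ : Position) : Run.neg Φ.toRun = Φ.neg.toRun := by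
  apply Stream'.Seq.ext
  intro n
  unfold Run.neg Position.neg
  rw [Stream'.Seq.map_get?]
  simp

theorem IsInit.neg {Φ : Position} {Γ : Run} (h : IsInit Φ Γ) : IsInit Φ.neg Γ.neg := by
  intro n m hm
  unfold Position.neg at hm
  rw [List.getElem?_map] at hm
  obtain ⟨m', h1, h2⟩ := Option.map_eq_some_iff.1 hm
  unfold Run.neg
  rw [Stream'.Seq.map_get?, h n m' h1, ← h2]
  rfl

/-- Negation `¬A`: the roles of the players are switched. -/
def Game.neg (A : Game) : Game where
  legal e := {Γ | Γ.neg ∈ A.legal e}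
  win e Γ := (A.win e Γ.neg).neg
  legal_iff := by
    intro e Γ
    change Γ.neg ∈ A.legal e ↔ ∀ Φ : Position, Φ ≠ [] → IsInit Φ Γ → Run.neg Φ.toRun ∈ A.legal e
    rw [A.legal_iff]
    constructor
    · intro h Φ hne hi
      rw [Position.toRun_neg]
      exact h _ (by simpa [Position.neg] using hne) hi.neg
    · intro h Φ hne hi
      have := h Φ.neg (by simpa [Position.neg] using hne) (by simpa [Run.neg_neg] using hi.neg)
      rwa [Position.toRun_neg, Position.neg_neg] at this
  no_spade := by
    intro e Γ h p n hn
    apply A.no_spade e _ h p.neg n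
    unfold Run.neg
    rw [Stream'.Seq.map_get?, hn]
    rfl
  win_illegal := by
    intro e Γ p h
    obtain ⟨Φ, α, hi, hn, hl⟩ := h
    refine congrArg Player.neg (A.win_illegal e Γ.neg p.neg ?_) |>.trans (by cases p <;> rfl)
    refine ⟨Φ.neg, α, ?_, ?_, ?_⟩
    · simpa [Position.neg] using hi.neg
    · have heq : Φ.neg ++ [(p.neg, α)] = Position.neg (Φ ++ [(p, α)]) := by simp [Position.neg]
      rw [heq, ← Position.toRun_neg]
      exact hn
    · intro Ψ hΨ
      have := hl Ψ.neg (by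
        have := hΨ.map (fun m : LabMove => (m.1.neg, m.2))
        rw [← Position.neg_neg Φ]
        exact this)
      simpa [Position.toRun_neg, Position.neg_neg] using this

theorem take_prefix (Γ : Run) {i j : ℕ} (h : i ≤ j) : Γ.take i <+: Γ.take j := by
  rw [List.prefix_iff_getElem?]
  intro n hn
  have h1 := Stream'.Seq.getElem?_take n i Γ
  have hni : n < i := lt_of_lt_of_le hn Stream'.Seq.length_take_le
  rw [Stream'.Seq.getElem?_take, if_pos (lt_of_lt_of_le hni h), ← List.getElem?_eq_getElem hn, h1,
    if_pos hni]

theorem isInit_take (Γ : Run) (k : ℕ) : IsInit (Γ.take k) Γ := by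
  intro n m hm
  rw [Stream'.Seq.getElem?_take] at hm
  split_ifs at hm
  exact hm

theorem IsInit.prefix_take {Φ : Position} {Γ : Run} (h : IsInit Φ Γ) :
    Φ <+: Γ.take Φ.length := by
  rw [List.prefix_iff_getElem?]
  intro i hi
  rw [Stream'.Seq.getElem?_take, if_pos hi]
  exact h i _ (List.getElem?_eq_getElem hi)

theorem take_toRun (Φ : Position) (k : ℕ) : (Position.toRun Φ).take k <+: Φ :=
  IsInit.toRun_iff.1 (isInit_take _ k)

theorem Run.proj_get? (γ : Move) (Γ : Run) (n : ℕ) (m : LabMove) :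
    (Run.proj γ Γ).get? n = some m ↔
      ∃ k, ((Γ.take k).filterMap (stripPrefix γ))[n]? = some m :=
  Run.limit_get? (fun _ _ h => (take_prefix Γ h).filterMap _) n m

theorem Run.isInit_proj_iff (γ : Move) (Γ : Run) (Ψ : Position) :
    IsInit Ψ (Run.proj γ Γ) ↔ ∃ k, Ψ <+: (Γ.take k).filterMap (stripPrefix γ) := by
  constructor
  · intro h
    induction Ψ using List.reverseRecOn with
    | nil => exact ⟨0, List.nil_prefix⟩
    | append_singleton Ψ m ih =>
      obtain ⟨k, hk⟩ := (Run.proj_get? γ Γ Ψ.length m).1 (h Ψ.length m (by simp))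
      obtain ⟨l, hl⟩ := ih (fun n m' hm' => h n m' (by
        obtain ⟨a, ha⟩ := List.getElem?_eq_some_iff.1 hm'
        rw [List.getElem?_append_left a, hm']))
      have hk' := (take_prefix Γ (le_max_left k l)).filterMap (stripPrefix γ)
      have hl' := hl.trans ((take_prefix Γ (le_max_right k l)).filterMap (stripPrefix γ))
      refine ⟨max k l, ?_⟩
      obtain ⟨T, hT⟩ := hl'
      obtain ⟨S, hS⟩ := hk'
      obtain ⟨a, -⟩ := List.getElem?_eq_some_iff.1 hk
      have hm : ((Γ.take (max k l)).filterMap (stripPrefix γ))[Ψ.length]? = some m := by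
        rw [← hS, List.getElem?_append_left a, hk]
      rw [← hT] at hm ⊢
      cases T with
      | nil => simp at hm
      | cons t T =>
        simp at hm
        subst hm
        exact ⟨T, by simp⟩
  · rintro ⟨k, hk⟩ n m hm
    rw [Run.proj_get?]
    refine ⟨k, ?_⟩
    obtain ⟨T, hT⟩ := hk
    obtain ⟨a, -⟩ := List.getElem?_eq_some_iff.1 hm
    rw [← hT, List.getElem?_append_left a, hm]

/-- The runs in which every move has one of the prefixes `1.`, …, `n.` and whose projection to
each component is legal there. -/
def parLegal {n : ℕ} (A : Fin n → Game) (e : Valuation) : Set Run :=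
  {Γ | (∀ k m, Γ.get? k = some m → ∃ i : Fin n, decimal (i + 1) ++ [Key.dot] <+: m.2) ∧
    ∀ i : Fin n, Run.proj (decimal (i + 1) ++ [Key.dot]) Γ ∈ (A i).legal e}

theorem parLegal_iff {n : ℕ} (A : Fin n → Game) (e : Valuation) (Γ : Run) :
    Γ ∈ parLegal A e ↔
      ∀ Φ : Position, Φ ≠ [] → IsInit Φ Γ → Φ.toRun ∈ parLegal A e := by
  constructor
  · rintro ⟨h1, h2⟩ Φ - hi
    refine ⟨fun k m hm => h1 k m (hi k m (by simpa using hm)), fun i => ?_⟩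
    rw [(A i).legal_iff]
    intro Ψ _ hΨ
    refine (A i).legal_of_init (h2 i) ?_
    rw [Run.isInit_proj_iff] at hΨ ⊢
    obtain ⟨k, hk⟩ := hΨ
    exact ⟨Φ.length, hk.trans (((take_toRun Φ k).trans hi.prefix_take).filterMap _)⟩
  · intro h
    refine ⟨fun k m hm => ?_, fun i => ?_⟩
    · have hk : (Γ.take (k + 1))[k]? = some m := by
        rw [Stream'.Seq.getElem?_take, if_pos (by omega), hm]
      have hne : Γ.take (k + 1) ≠ [] := by
        intro h0
        rw [h0] at hk
        simp at hk
      exact (h _ hne (isInit_take Γ (k + 1))).1 k m (by simpa using hk)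
    · rw [(A i).legal_iff]
      intro Ψ hne hΨ
      rw [Run.isInit_proj_iff] at hΨ
      obtain ⟨k, hk⟩ := hΨ
      have hne' : Γ.take k ≠ [] := by
        intro h0
        rw [h0] at hk
        exact hne (List.prefix_nil.1 (by simpa using hk))
      refine (A i).legal_of_init ((h _ hne' (isInit_take Γ k)).2 i) ?_
      rw [Run.isInit_proj_iff]
      refine ⟨(Γ.take k).length, hk.trans ?_⟩
      exact (IsInit.prefix_take (IsInit.toRun_iff.2 List.prefix_rfl)).filterMap _

open scoped Classical in
/-- Parallel conjunction `A₁ ∧ … ∧ Aₙ`. -/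
noncomputable def Game.pand {n : ℕ} (A : Fin n → Game) : Game :=
  Game.ofLegal (parLegal A)
    (fun e Γ =>
      if ∀ i : Fin n, (A i).win e (Run.proj (decimal (i + 1) ++ [Key.dot]) Γ) = .top
      then .top else .bot)
    (parLegal_iff A)
    (by
      rintro e Γ ⟨h1, -⟩ p k hk
      obtain ⟨i, T, hT⟩ := h1 k _ hk
      rw [List.append_assoc] at hT
      exact decimal_head _ _ hT)

/-- Parallel disjunction `A₁ ∨ … ∨ Aₙ`. -/
noncomputable def Game.por {n : ℕ} (A : Fin n → Game) : Game :=
  (Game.pand fun i => (A i).neg).neg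

/-- Parallel implication `A → B`, i.e. `¬A ∨ B`. -/
noncomputable def Game.imp (A B : Game) : Game := Game.por ![A.neg, B]

/-- The empty run, and the runs in which the environment first makes the move `name i` and which
then continue as a legal run of `A i`. -/
def choiceLegal {ι : Type} (name : ι → Move) (A : ι → Game) (e : Valuation) : Set Run :=
  {Γ | Γ = Stream'.Seq.nil ∨
    ∃ i Δ, Δ ∈ (A i).legal e ∧ Γ = Stream'.Seq.cons (Player.bot, name i) Δ}

theorem choiceLegal_iff {ι : Type} {name : ι → Move} (hname : Function.Injective name)
    (A : ι → Game) (e : Valuation) (Γ : Run) :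
    Γ ∈ choiceLegal name A e ↔
      ∀ Φ : Position, Φ ≠ [] → IsInit Φ Γ → Φ.toRun ∈ choiceLegal name A e := by
  constructor
  · rintro (rfl | ⟨i, Δ, hΔ, rfl⟩) Φ hne hi
    · obtain ⟨m, t, rfl⟩ := List.exists_cons_of_ne_nil hne
      have := hi 0 m (by simp)
      simp at this
    · obtain ⟨m, t, rfl⟩ := List.exists_cons_of_ne_nil hne
      have h0 := hi 0 m (by simp)
      simp at h0
      refine Or.inr ⟨i, Position.toRun t, (A i).legal_of_init hΔ ?_, ?_⟩
      · intro n m' hm'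
        have := hi (n + 1) m' (by simpa using hm')
        simpa using this
      · rw [← h0]; exact Stream'.Seq.ofList_cons _ _
  · intro h
    by_cases hΓ : Γ = Stream'.Seq.nil
    · exact Or.inl hΓ
    · have h0 : Γ.get? 0 ≠ none := fun h0 => hΓ (Stream'.Seq.get?_zero_eq_none.1 h0)
      obtain ⟨m, hm⟩ := Option.ne_none_iff_exists'.1 h0
      have hcons : Γ = Stream'.Seq.cons m Γ.tail := by
        apply Stream'.Seq.ext
        intro n
        cases n with
        | zero => simpa using hm
        | succ n => simp
      have step : ∀ t : Position, IsInit t Γ.tail → ∃ i, m = (Player.bot, name i) ∧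
          Position.toRun t ∈ (A i).legal e := by
        intro t ht
        have hi : IsInit (m :: t) Γ := by
          intro n m' hm'
          cases n with
          | zero => simp at hm'; rw [hm, hm']
          | succ n =>
            have := ht n m' (by simpa using hm')
            simpa using this
        have hc : Position.toRun (m :: t) = Stream'.Seq.cons m (Position.toRun t) :=
          Stream'.Seq.ofList_cons _ _
        rcases h (m :: t) (by simp) hi with h' | ⟨i, Δ, hΔ, h'⟩
        · rw [hc] at h'
          exact absurd h' Stream'.Seq.cons_ne_nil
        · rw [hc, Stream'.Seq.cons_eq_cons] at h'
          exact ⟨i, h'.1, by rw [h'.2]; exact hΔ⟩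
      obtain ⟨i, hi, -⟩ := step [] (fun n m' hm' => by simp at hm')
      refine Or.inr ⟨i, Γ.tail, ?_, by rw [← hi]; exact hcons⟩
      rw [(A i).legal_iff]
      intro Φ _ hΦ
      obtain ⟨j, hj, hleg⟩ := step Φ hΦ
      have : j = i := by
        rw [hi] at hj
        exact hname (Prod.mk.inj hj).2.symm
      rwa [← this]

open scoped Classical in
/-- The environment chooses one of the games `A i` by making the move `name i`; if it does not
choose, the machine wins. -/
noncomputable def Game.choice {ι : Type} (name : ι → Move) (hname : Function.Injective name)
    (hsp : ∀ i, name i ≠ [Key.spade]) (A : ι → Game) : Game :=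
  Game.ofLegal (choiceLegal name A)
    (fun e Γ =>
      if ∃ i Δ, Γ = Stream'.Seq.cons (Player.bot, name i) Δ ∧ (A i).win e Δ = .bot
      then .bot else .top)
    (choiceLegal_iff hname A)
    (by
      rintro e Γ (rfl | ⟨i, Δ, hΔ, rfl⟩) p n
      · simp
      · cases n with
        | zero =>
          intro h
          simp at h
          exact hsp i h.2
        | succ n => simpa using (A i).no_spade e Δ hΔ p n)

/-- Choice conjunction `A₁ ⊓ … ⊓ Aₙ`, the `i`-th game being chosen by the numeral of `i`. -/
noncomputable def Game.cand {n : ℕ} (A : Fin n → Game) : Game :=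
  Game.choice (fun i : Fin n => decimal (i + 1))
    (fun i j h => Fin.ext (by have := decimal_injective h; omega))
    (fun i => by simpa using decimal_head (i + 1) []) A

/-- Choice disjunction `A₁ ⊔ … ⊔ Aₙ`. -/
noncomputable def Game.cor {n : ℕ} (A : Fin n → Game) : Game :=
  (Game.cand fun i => (A i).neg).neg

/-- Choice universal quantification `⊓x A(x)`. -/
noncomputable def Game.call (x : Var) (A : Game) : Game :=
  Game.choice decimal decimal_injective (fun c => by simpa using decimal_head c [])
    (fun c => A.inst x c)

/-- Choice existential quantification `⊔x A(x)`. -/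
noncomputable def Game.cex (x : Var) (A : Game) : Game := (Game.call x A.neg).neg

open scoped Classical in
/-- Blind universal quantification `∀x A(x)`. (For games whose structure does not depend on `x`,
in particular for all games expressed by formulas, the winner of an illegal run is the same with
all values of `x`.) -/
noncomputable def Game.ball (x : Var) (A : Game) : Game :=
  Game.ofLegal A.legal
    (fun e Γ => if ∀ c, (A.inst x c).win e Γ = .top then .top else .bot)
    A.legal_iff A.no_spade

/-- Blind existential quantification `∃x A(x)`. -/
noncomputable def Game.bex (x : Var) (A : Game) : Game := (Game.ball x A.neg).neg

/-! ### Formulas and interpretations -/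

/-- Predicate letters: infinitely many of each arity. -/
structure PredLetter where
  arity : ℕ
  index : ℕ
  deriving DecidableEq

/-- The formulas. The `n`-ary connectives have at least two arguments. -/
inductive Formula where
  | atom (p : PredLetter) (t : Fin p.arity → Term)
  | top
  | bot
  | neg (F : Formula)
  | pand (n : ℕ) (F : Fin (n + 2) → Formula)
  | por (n : ℕ) (F : Fin (n + 2) → Formula)
  | imp (F G : Formula)
  | cand (n : ℕ) (F : Fin (n + 2) → Formula)
  | cor (n : ℕ) (F : Fin (n + 2) → Formula)
  | ball (x : Var) (F : Formula)
  | bex (x : Var) (F : Formula)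
  | call (x : Var) (F : Formula)
  | cex (x : Var) (F : Formula)

/-- The variable `x` occurs in the formula (free, bound, or next to a quantifier). -/
def Formula.Occurs (x : Var) : Formula → Prop
  | .atom _ t => ∃ i, t i = .var x
  | .top => False
  | .bot => False
  | .neg F => F.Occurs x
  | .pand _ F => ∃ i, (F i).Occurs x
  | .por _ F => ∃ i, (F i).Occurs x
  | .imp F G => F.Occurs x ∨ G.Occurs x
  | .cand _ F => ∃ i, (F i).Occurs x
  | .cor _ F => ∃ i, (F i).Occurs x
  | .ball y F => y = x ∨ F.Occurs x
  | .bex y F => y = x ∨ F.Occurs x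
  | .call y F => y = x ∨ F.Occurs x
  | .cex y F => y = x ∨ F.Occurs x

/-- An interpretation sends each predicate letter to an elementary game with an attached tuple of
pairwise distinct variables. -/
structure Interpretation where
  game : PredLetter → Game
  elementary : ∀ p, (game p).IsElementary
  vars : (p : PredLetter) → Fin p.arity → Var
  vars_injective : ∀ p, Function.Injective (vars p)

/-- The game `F*`. -/
noncomputable def Interpretation.apply (I : Interpretation) : Formula → Game
  | .atom p t => (I.game p).subst (I.vars p) t
  | .top => Game.trivial .top
  | .bot => Game.trivial .bot
  | .neg F => (I.apply F).neg
  | .pand _ F => Game.pand fun i => I.apply (F i)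
  | .por _ F => Game.por fun i => I.apply (F i)
  | .imp F G => Game.imp (I.apply F) (I.apply G)
  | .cand _ F => Game.cand fun i => I.apply (F i)
  | .cor _ F => Game.cor fun i => I.apply (F i)
  | .ball x F => Game.ball x (I.apply F)
  | .bex x F => Game.bex x (I.apply F)
  | .call x F => Game.call x (I.apply F)
  | .cex x F => Game.cex x (I.apply F)

/-- `F`-admissible interpretations. -/
def Interpretation.Admissible (I : Interpretation) (F : Formula) : Prop :=
  ∀ p x, F.Occurs x → (∀ i, I.vars p i ≠ x) → ¬ (I.game p).DependsOn x

/-! ### Hard-play machines -/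

/-- What a head sees: the marker at the left end of the tape, or the symbol in a cell. -/
inductive Scanned (S : Type) where
  | leftEnd
  | cell (s : S)

/-- The tapes are infinite to the right. Head position `0` is the left-end marker, head position
`n + 1` is the `n`-th cell. -/
def scan {S : Type} (T : ℕ → S) : ℕ → Scanned S
  | 0 => .leftEnd
  | n + 1 => .cell (T n)

inductive Dir where
  | left
  | stay
  | right

/-- A head at the left end stays there when told to move left. -/
def Dir.shift : Dir → ℕ → ℕ
  | .left, h => h - 1
  | .stay, h => h
  | .right, h => h + 1

/-- Contents of the valuation tape: the numerals of `e(v₀), e(v₁), …`, each followed by a blank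
(`none`). Since each block is nonempty, the first `n + 1` blocks determine the `n`-th cell. -/
def valTape (e : Valuation) (n : ℕ) : Option (Fin 10) :=
  (((List.range (n + 1)).flatMap fun i => (decimalDigits (e i)).map some ++ [none])[n]?).join

/-- Contents of the run tape: the labmoves of the position one after another, each spelled as its
label followed by its move; then blanks. -/
def runTape (Φ : Position) (n : ℕ) : Option (Player ⊕ Key) :=
  (Φ.flatMap fun m => Sum.inl m.1 :: m.2.map Sum.inr)[n]?

/-- The result of one application of the transition function: the next state, the symbol written on
the work tape (`none` is the blank) and the movements of the three heads. -/
structure Action (State Aux : Type) where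
  state : State
  write : Option (Key ⊕ Aux)
  valDir : Dir
  runDir : Dir
  workDir : Dir

/-- A hard-play machine: a Turing machine with a read-only valuation tape, a read-only run tape, and
a read/write work tape whose alphabet consists of the blank, the keyboard symbols and finitely many
auxiliary symbols. -/
structure HPM where
  State : Type
  Aux : Type
  finite_state : Finite State
  finite_aux : Finite Aux
  start : State
  moveStates : Set State
  trans : State → Scanned (Option (Fin 10)) → Scanned (Option (Player ⊕ Key)) →
    Scanned (Option (Key ⊕ Aux)) → Action State Aux

/-- Configurations; `run` is the position spelled on the run tape. -/
structure HPM.Config (H : HPM) where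
  state : H.State
  valHead : ℕ
  runHead : ℕ
  workHead : ℕ
  work : ℕ → Option (Key ⊕ H.Aux)
  run : Position

/-- All tapes but the valuation tape are empty and all heads are at the left end. -/
def HPM.init (H : HPM) : H.Config where
  state := H.start
  valHead := 0
  runHead := 0
  workHead := 0
  work := fun _ => none
  run := []

/-- The longest initial string of keyboard symbols. -/
def leadingKeys {Aux : Type} : List (Option (Key ⊕ Aux)) → Move
  | some (Sum.inl k) :: l => k :: leadingKeys l
  | _ => []

/-- The move constructed on the work tape: the string of keyboard symbols at the beginning of the
tape, delimited by the head (or by the first other symbol). -/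
def HPM.Config.move {H : HPM} (C : H.Config) : Move :=
  leadingKeys ((List.range (C.workHead - 1)).map C.work)

/-- Writing at the left-end marker has no effect. -/
def writeAt {S : Type} (T : ℕ → S) (s : S) : ℕ → (ℕ → S)
  | 0 => T
  | n + 1 => Function.update T n s

open scoped Classical in
/-- The configuration following `C` if the environment makes the moves `βs` during the clock cycle.
The machine makes a move during the cycle iff it is in a move state. -/
noncomputable def HPM.next (H : HPM) (e : Valuation) (C : H.Config) (βs : List Move) : H.Config :=
  let a := H.trans C.state (scan (valTape e) C.valHead) (scan (runTape C.run) C.runHead)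
    (scan C.work C.workHead)
  { state := a.state
    valHead := a.valDir.shift C.valHead
    runHead := a.runDir.shift C.runHead
    workHead := a.workDir.shift C.workHead
    work := writeAt C.work a.write C.workHead
    run := C.run ++ βs.map (fun β => (Player.bot, β)) ++
      (if C.state ∈ H.moveStates then [(Player.top, C.move)] else []) }

/-- `e`-computation branches. -/
def HPM.IsBranch (H : HPM) (e : Valuation) (B : ℕ → H.Config) : Prop :=
  B 0 = H.init ∧ ∀ n, ∃ βs : List Move, B (n + 1) = H.next e (B n) βs

/-- The run spelled by a branch. -/
noncomputable def HPM.spelled {H : HPM} (B : ℕ → H.Config) : Run :=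
  Run.limit fun n => (B n).run

/-- `H` wins `A` on the valuation `e`. -/
def HPM.WinsOn (H : HPM) (e : Valuation) (A : Game) : Prop :=
  ∀ B : ℕ → H.Config, H.IsBranch e B → A.win e (HPM.spelled B) = .top

/-- `H` wins `A`. -/
def HPM.Wins (H : HPM) (A : Game) : Prop := ∀ e, H.WinsOn e A

/-- `A` is computable. -/
def Game.Computable (A : Game) : Prop := ∃ H : HPM, H.Wins A

/-! ### Validity -/

def Formula.Valid (F : Formula) : Prop :=
  ∀ I : Interpretation, I.Admissible F → (I.apply F).Computable

def Formula.UniformlyValid (F : Formula) : Prop :=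
  ∃ H : HPM, ∀ I : Interpretation, I.Admissible F → H.Wins (I.apply F)

end CoL

/-! The game `F*` at a valuation `e` depends only on the values of `e` at the variables of `F` and
on the model of the predicate letters that `*` induces at `e`. Since `e` also has variables that do
not occur in `F`, a single interpretation can induce different models at different valuations, and
can diagonalise against all machines `H₀, H₁, …` at once. The obstacle is that the marker `k`,
coded in the values of those variables, has to appear on the valuation tape. So suppose that `F` is
not uniformly valid, and let `Kₖ` run `Hₖ` but read the digits on the valuation tape as if the
valuation had the marker `k`; counting the blocks of the tape modulo a number that depends on `k`
suffices for this. Since `Kₖ` does not show that `F` is uniformly valid, it loses `F*` at some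
valuation `eₖ` for some interpretation `*`. The diagonal interpretation induces, at all valuations
with the marker `k`, the model that this `*` induces at `eₖ`. If `Hₖ` won it, then `Kₖ` would win
`F*` at `eₖ`. -/

namespace CoL

/-! ### Games at a fixed valuation -/

/-- The game `A` at the valuation `e` is the same as the game `B` at the valuation `e'`. -/
def Game.Agree (A : Game) (e : Valuation) (B : Game) (e' : Valuation) : Prop :=
  A.legal e = B.legal e' ∧ A.win e = B.win e'

namespace Game.Agree

variable {A B A' B' : Game} {n : ℕ} {As Bs : Fin n → Game} {x : Var} {e e' e'' : Valuation}

theorem trans (h : A.Agree e A' e') (h' : A'.Agree e' B e'') : A.Agree e B e'' :=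
  ⟨h.1.trans h'.1, h.2.trans h'.2⟩

theorem ofLegal {L L' : Valuation → Set Run} {w w' : Valuation → Run → Player} {hL hs hL' hs'}
    (hleg : L e = L' e') (hwin : w e = w' e') :
    (Game.ofLegal L w hL hs).Agree e (Game.ofLegal L' w' hL' hs') e' :=
  ⟨hleg, by unfold Game.ofLegal; simp only [hwin]; rw [hleg]⟩

theorem trivial (p : Player) (e e' : Valuation) : (Game.trivial p).Agree e (Game.trivial p) e' :=
  ofLegal rfl rfl

theorem neg (h : A.Agree e B e') : A.neg.Agree e B.neg e' := by
  simp only [Agree, Game.neg, h.1, h.2, and_self]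

theorem pand (h : ∀ i, (As i).Agree e (Bs i) e') : (Game.pand As).Agree e (Game.pand Bs) e' :=
  ofLegal (by simp only [parLegal, (h _).1]) (by simp only [(h _).2])

theorem por (h : ∀ i, (As i).Agree e (Bs i) e') : (Game.por As).Agree e (Game.por Bs) e' :=
  (pand fun i => (h i).neg).neg

theorem imp (h : A.Agree e B e') (h' : A'.Agree e B' e') :
    (Game.imp A A').Agree e (Game.imp B B') e' :=
  por (Fin.forall_fin_two.2 ⟨h.neg, h'⟩)

open scoped Classical in
theorem choice {ι : Type} {name : ι → Move} {hname hsp} {As Bs : ι → Game}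
    (h : ∀ i, (As i).Agree e (Bs i) e') :
    (Game.choice name hname hsp As).Agree e (Game.choice name hname hsp Bs) e' :=
  ofLegal (by simp only [choiceLegal, (h _).1])
    (funext fun _ => if_congr (by simp only [(h _).2]) rfl rfl)

theorem cand (h : ∀ i, (As i).Agree e (Bs i) e') : (Game.cand As).Agree e (Game.cand Bs) e' :=
  choice h

theorem cor (h : ∀ i, (As i).Agree e (Bs i) e') : (Game.cor As).Agree e (Game.cor Bs) e' :=
  (cand fun i => (h i).neg).neg

theorem call (h : ∀ c, A.Agree (Function.update e x c) B (Function.update e' x c)) :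
    (Game.call x A).Agree e (Game.call x B) e' :=
  choice h

theorem cex (h : ∀ c, A.Agree (Function.update e x c) B (Function.update e' x c)) :
    (Game.cex x A).Agree e (Game.cex x B) e' :=
  (call fun c => (h c).neg).neg

open scoped Classical in
theorem ball (hleg : A.legal e = B.legal e')
    (h : ∀ c, A.Agree (Function.update e x c) B (Function.update e' x c)) :
    (Game.ball x A).Agree e (Game.ball x B) e' :=
  ofLegal hleg (funext fun _ => if_congr (by simp only [Game.inst, (h _).2]) rfl rfl)

theorem bex (hleg : A.legal e = B.legal e')
    (h : ∀ c, A.Agree (Function.update e x c) B (Function.update e' x c)) :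
    (Game.bex x A).Agree e (Game.bex x B) e' :=
  (ball (congrArg (Run.neg ⁻¹' ·) hleg) fun c => (h c).neg).neg

theorem of_not_dependsOn {s : Finset Var} (hs : ∀ x ∈ s, ¬ A.DependsOn x)
    (h : ∀ x ∉ s, e x = e' x) : A.Agree e A e' := by
  induction s using Finset.induction generalizing e with
  | empty =>
    obtain rfl : e = e' := funext fun x => h x (Finset.notMem_empty x)
    exact ⟨rfl, rfl⟩
  | insert x s _ ih =>
    rw [Finset.forall_mem_insert] at hs
    have hx : A.Agree e A (Function.update e x (e' x)) := by
      by_contra hne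
      exact hs.1 ⟨e, _, fun y hy => (Function.update_of_ne hy _ _).symm, not_and_or.1 hne⟩
    refine hx.trans (ih hs.2 fun y hy => ?_)
    obtain rfl | hyx := eq_or_ne y x
    · exact Function.update_self _ _ _
    · rw [Function.update_of_ne hyx, h y (by simp [hyx, hy])]

end Game.Agree

theorem Game.nil_mem_legal (A : Game) (e : Valuation) : Stream'.Seq.nil ∈ A.legal e :=
  (A.legal_iff e _).2 fun Φ hne hi => by
    obtain ⟨m, t, rfl⟩ := List.exists_cons_of_ne_nil hne
    simpa using hi 0 m (by simp)

namespace Game.IsElementary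

variable {A B : Game} {e e' : Valuation}

theorem legal_eq (hA : A.IsElementary) (e : Valuation) : A.legal e = {Stream'.Seq.nil} :=
  Set.Subset.antisymm (hA e) (Set.singleton_subset_iff.2 (A.nil_mem_legal e))

theorem win_cons (hA : A.IsElementary) (e : Valuation) (p : Player) (α : Move) (Γ : Run) :
    A.win e (Stream'.Seq.cons (p, α) Γ) = p.neg := by
  refine A.win_illegal e _ p ⟨[], α, ?_, fun h => ?_, fun Ψ hΨ => ?_⟩
  · rintro (_ | n) m hm
    · simpa using hm
    · simp at hm
  · exact Stream'.Seq.cons_ne_nil ((Stream'.Seq.ofList_cons _ _).symm.trans (hA e _ h))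
  · rw [List.prefix_nil.1 hΨ]
    exact A.nil_mem_legal e

theorem agree (hA : A.IsElementary) (hB : B.IsElementary)
    (h : A.win e Stream'.Seq.nil = B.win e' Stream'.Seq.nil) : A.Agree e B e' := by
  refine ⟨by rw [hA.legal_eq, hB.legal_eq], funext fun Γ => ?_⟩
  cases Γ using Stream'.Seq.recOn with
  | nil => exact h
  | cons m Γ => rw [hA.win_cons, hB.win_cons]

end Game.IsElementary

/-! ### Interpreted formulas depend only on the induced model -/

/-- A first-order model on the constants, `Player.top` being the truth value "true". -/
abbrev Model := (p : PredLetter) → (Fin p.arity → ℕ) → Player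

/-- The model of the predicate letters that an interpretation induces at a valuation. -/
noncomputable def Interpretation.model (I : Interpretation) (e : Valuation) : Model :=
  fun p a => (I.game p).win (Function.extend (I.vars p) a e) Stream'.Seq.nil

theorem Formula.finite_occurs (F : Formula) : {x | F.Occurs x}.Finite := by
  induction F with
  | atom p t =>
    have hvar : ∀ s : Term, {x | s = .var x}.Finite := fun s =>
      Set.Subsingleton.finite fun x hx y hy => Term.var.inj (hx.symm.trans hy)
    simpa only [Occurs, Set.ofPred_exists] using Set.finite_iUnion fun i => hvar (t i)
  | top | bot => exact Set.finite_empty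
  | neg _ ih => exact ih
  | pand _ _ ih | por _ _ ih | cand _ _ ih | cor _ _ ih =>
    simpa only [Occurs, Set.ofPred_exists] using Set.finite_iUnion ih
  | imp _ _ ihF ihG => exact ihF.union ihG
  | ball x _ ih | bex x _ ih | call x _ ih | cex x _ ih =>
    exact ((Set.finite_singleton x).union ih).subset fun y hy => hy.imp_left Eq.symm

theorem Formula.exists_forall_occurs_lt (F : Formula) : ∃ N, ∀ x, F.Occurs x → x < N :=
  let ⟨N, hN⟩ := F.finite_occurs.bddAbove
  ⟨N + 1, fun _ hx => Nat.lt_succ_of_le (hN hx)⟩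

theorem Term.eval_congr {t : Term} {e e' : Valuation} (h : ∀ x, t = .var x → e x = e' x) :
    t.eval e = t.eval e' := by
  cases t with
  | var x => exact h x rfl
  | const c => rfl

namespace Interpretation

variable {I J : Interpretation} {F : Formula} {e e' : Valuation}

-- The quantifiers of `F` change a valuation only on `S`, so the induction has to range over all
-- valuations that differ from `e` only there.
theorem agree_apply_of_forall_atom {S : Finset Var}
    (hatom : ∀ p t, (∀ x, (Formula.atom p t).Occurs x → x ∈ S) → ∀ u : Valuation,
      (I.apply (.atom p t)).Agree (S.piecewise u e) (J.apply (.atom p t)) (S.piecewise u e'))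
    (hF : ∀ x, F.Occurs x → x ∈ S) (u : Valuation) :
    (I.apply F).Agree (S.piecewise u e) (J.apply F) (S.piecewise u e') := by
  have update {x : Var} (hx : x ∈ S) {G : Formula}
      (hG : ∀ u, (I.apply G).Agree (S.piecewise u e) (J.apply G) (S.piecewise u e'))
      (u : Valuation) (c : ℕ) :
      (I.apply G).Agree (Function.update (S.piecewise u e) x c)
        (J.apply G) (Function.update (S.piecewise u e') x c) := by
    simpa only [S.update_piecewise_of_mem u e hx c, S.update_piecewise_of_mem u e' hx c]
      using hG (Function.update u x c)
  induction F generalizing u with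
  | atom p t => exact hatom p t hF u
  | top | bot => exact .trivial _ _ _
  | neg _ ih => exact (ih hF u).neg
  | pand _ _ ih => exact .pand fun i => ih i (fun x hx => hF x ⟨i, hx⟩) u
  | por _ _ ih => exact .por fun i => ih i (fun x hx => hF x ⟨i, hx⟩) u
  | imp _ _ ihF ihG =>
    exact .imp (ihF (fun x hx => hF x (.inl hx)) u) (ihG (fun x hx => hF x (.inr hx)) u)
  | cand _ _ ih => exact .cand fun i => ih i (fun x hx => hF x ⟨i, hx⟩) u
  | cor _ _ ih => exact .cor fun i => ih i (fun x hx => hF x ⟨i, hx⟩) u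
  | ball x _ ih =>
    have hG := ih fun y hy => hF y (.inr hy)
    exact .ball (hG u).1 (update (hF x (.inl rfl)) hG u)
  | bex x _ ih =>
    have hG := ih fun y hy => hF y (.inr hy)
    exact .bex (hG u).1 (update (hF x (.inl rfl)) hG u)
  | call x _ ih =>
    exact .call (update (hF x (.inl rfl)) (ih fun y hy => hF y (.inr hy)) u)
  | cex x _ ih =>
    exact .cex (update (hF x (.inl rfl)) (ih fun y hy => hF y (.inr hy)) u)

theorem Admissible.model_congr (hI : I.Admissible F) (h : ∀ x, ¬ F.Occurs x → e x = e' x) :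
    I.model e = I.model e' := by
  ext p a
  let s := {x ∈ F.finite_occurs.toFinset | ∀ i, I.vars p i ≠ x}
  have hs : ∀ x ∈ s, ¬ (I.game p).DependsOn x := fun x hx => by
    rw [Finset.mem_filter, Set.Finite.mem_toFinset] at hx
    exact hI p x hx.1 hx.2
  refine congrFun (Game.Agree.of_not_dependsOn hs fun x hx => ?_).2 _
  by_cases hvars : ∃ i, I.vars p i = x
  · obtain ⟨i, rfl⟩ := hvars
    rw [(I.vars_injective p).extend_apply, (I.vars_injective p).extend_apply]
  · rw [Function.extend_apply' _ _ _ hvars, Function.extend_apply' _ _ _ hvars]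
    refine h x fun hocc => hx ?_
    rw [Finset.mem_filter, Set.Finite.mem_toFinset]
    exact ⟨hocc, not_exists.1 hvars⟩

theorem Admissible.agree_apply (hI : I.Admissible F) (hJ : J.Admissible F)
    (hmodel : I.model e = J.model e') (h : ∀ x, F.Occurs x → e x = e' x) :
    (I.apply F).Agree e (J.apply F) e' := by
  let S := F.finite_occurs.toFinset
  have mem_S {x : Var} : x ∈ S ↔ F.Occurs x := F.finite_occurs.mem_toFinset
  have model_piecewise {K : Interpretation} (hK : K.Admissible F) (u d : Valuation) :
      K.model (S.piecewise u d) = K.model d :=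
    hK.model_congr fun x hx => S.piecewise_eq_of_notMem u d (mt mem_S.1 hx)
  have hatom p t (ht : ∀ x, (Formula.atom p t).Occurs x → x ∈ S) (u : Valuation) :
      (I.apply (.atom p t)).Agree (S.piecewise u e) (J.apply (.atom p t)) (S.piecewise u e') := by
    refine Game.IsElementary.agree (fun _ => I.elementary p _) (fun _ => J.elementary p _) ?_
    have hargs : (fun i => (t i).eval (S.piecewise u e)) = fun i => (t i).eval (S.piecewise u e') :=
      funext fun i => Term.eval_congr fun x hx => by
        simp only [Finset.piecewise_eq_of_mem _ _ _ (ht x ⟨i, hx⟩)]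
    change I.model (S.piecewise u e) p _ = J.model (S.piecewise u e') p _
    rw [model_piecewise hI, model_piecewise hJ, hmodel, hargs]
  have hagree := agree_apply_of_forall_atom hatom (fun _ => mem_S.2) e
  have he' : S.piecewise e e' = e' := funext fun x => by
    by_cases hx : x ∈ S
    · rw [Finset.piecewise_eq_of_mem _ _ _ hx, h x (mem_S.1 hx)]
    · exact Finset.piecewise_eq_of_notMem _ _ _ hx
  rwa [Finset.piecewise_same, he'] at hagree

end Interpretation

/-! ### Blocks of the valuation tape -/

/-- The cell of the valuation tape at which the numeral of `e i` begins. -/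
def blockStart (e : Valuation) (i : ℕ) : ℕ :=
  ∑ k ∈ Finset.range i, ((decimalDigits (e k)).length + 1)

section

variable {e e' : Valuation} {i j : ℕ}

theorem blockStart_succ (e : Valuation) (i : ℕ) :
    blockStart e (i + 1) = blockStart e i + (decimalDigits (e i)).length + 1 :=
  Finset.sum_range_succ _ i

theorem length_flatMap_range (e : Valuation) (i : ℕ) :
    ((List.range i).flatMap fun k => (decimalDigits (e k)).map some ++ [none]).length =
      blockStart e i := by
  induction i with
  | zero => rfl
  | succ i ih =>
    simp only [List.range_succ, List.flatMap_append, List.length_append, ih, blockStart_succ,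
      List.flatMap_singleton, List.length_map, List.length_singleton, Nat.add_assoc]

theorem le_blockStart (e : Valuation) (i : ℕ) : i ≤ blockStart e i := by
  induction i with
  | zero => exact Nat.zero_le _
  | succ i ih => rw [blockStart_succ]; lia

theorem exists_eq_blockStart_add (e : Valuation) (n : ℕ) :
    ∃ i, ∃ j ≤ (decimalDigits (e i)).length, n = blockStart e i + j := by
  induction n with
  | zero => exact ⟨0, 0, Nat.zero_le _, rfl⟩
  | succ n ih =>
    obtain ⟨i, j, hj, rfl⟩ := ih
    obtain hj | rfl := hj.lt_or_eq
    · exact ⟨i, j + 1, hj, rfl⟩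
    · exact ⟨i + 1, 0, Nat.zero_le _, (blockStart_succ e i).symm⟩

theorem valTape_blockStart_add (hj : j ≤ (decimalDigits (e i)).length) :
    valTape e (blockStart e i + j) = (decimalDigits (e i))[j]? := by
  obtain ⟨d, hd⟩ : ∃ d, blockStart e i + j + 1 = i + (d + 1) :=
    ⟨blockStart e i + j - i, by have := le_blockStart e i; lia⟩
  rw [valTape, hd, List.range_add, List.flatMap_append, ← length_flatMap_range,
    List.getElem?_append_right (Nat.le_add_right _ _), Nat.add_sub_cancel_left,
    List.range_succ_eq_map]
  obtain hj | rfl := hj.lt_or_eq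
  · simp [List.getElem?_append, hj]
  · simp

theorem count_blockStart_add (hj : j ≤ (decimalDigits (e i)).length) :
    Nat.count (valTape e · = none) (blockStart e i + j) = i := by
  have start_add {i j : ℕ} (hj : j ≤ (decimalDigits (e i)).length) :
      Nat.count (valTape e · = none) (blockStart e i + j) =
        Nat.count (valTape e · = none) (blockStart e i) := by
    rw [Nat.count_add, Nat.add_eq_left, Nat.count_iff_forall_not]
    intro k hk
    rw [valTape_blockStart_add (hk.le.trans hj), List.getElem?_eq_getElem (hk.trans_le hj)]
    exact Option.some_ne_none _
  have count_start (i : ℕ) : Nat.count (valTape e · = none) (blockStart e i) = i := by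
    induction i with
    | zero => rfl
    | succ i ih =>
      rw [blockStart_succ, Nat.count_succ, start_add le_rfl, ih, valTape_blockStart_add le_rfl,
        List.getElem?_length, if_pos rfl]
  rw [start_add hj, count_start]

theorem valTape_eq_map {g : ℕ → Fin 10 → Fin 10}
    (h : ∀ i, decimalDigits (e' i) = (decimalDigits (e i)).map (g i)) (n : ℕ) :
    valTape e' n = (valTape e n).map (g (Nat.count (valTape e · = none) n)) := by
  obtain ⟨i, j, hj, rfl⟩ := exists_eq_blockStart_add e n
  have hstart : blockStart e i = blockStart e' i := by simp only [blockStart, h, List.length_map]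
  rw [count_blockStart_add hj, valTape_blockStart_add hj, hstart,
    valTape_blockStart_add (by rwa [h, List.length_map]), h, List.getElem?_map]

end

/-! ### Runs of machines -/

namespace HPM

variable {H H' : HPM} {e e' : Valuation} {A : Game}

/-- The configuration of `H` after `n` clock cycles if the environment makes the moves `β k` during
the `k`-th one. -/
noncomputable def config (H : HPM) (e : Valuation) (β : ℕ → List Move) : ℕ → H.Config
  | 0 => H.init
  | n + 1 => H.next e (H.config e β n) (β n)

/-- The run that `H` generates against the environment behaviour `β`. -/
noncomputable def play (H : HPM) (e : Valuation) (β : ℕ → List Move) : Run :=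
  HPM.spelled (H.config e β)

theorem isBranch_iff {B : ℕ → H.Config} : H.IsBranch e B ↔ ∃ β, B = H.config e β := by
  constructor
  · rintro ⟨hinit, hnext⟩
    choose β hβ using hnext
    refine ⟨β, funext fun n => ?_⟩
    induction n with
    | zero => exact hinit
    | succ n ih => rw [hβ, ih, config]
  · rintro ⟨β, rfl⟩
    exact ⟨rfl, fun n => ⟨β n, rfl⟩⟩

theorem winsOn_iff : H.WinsOn e A ↔ ∀ β, A.win e (H.play e β) = .top := by
  simp only [WinsOn, isBranch_iff, forall_exists_index, forall_eq_apply_imp_iff, play]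

theorem play_eq_of_simulation (R : H.Config → H'.Config → Prop) (hinit : R H.init H'.init)
    (hnext : ∀ C C' βs, R C C' → R (H.next e C βs) (H'.next e' C' βs))
    (hrun : ∀ C C', R C C' → C.run = C'.run) (β : ℕ → List Move) :
    H.play e β = H'.play e' β := by
  have hR (n : ℕ) : R (H.config e β n) (H'.config e' β n) := by
    induction n with
    | zero => exact hinit
    | succ n ih => exact hnext _ _ _ ih
  exact congrArg Run.limit (funext fun n => hrun _ _ (hR n))

end HPM

/-- Applies `f` to the scanned symbol. -/
def Scanned.map {S S' : Type} (f : S → S') : Scanned S → Scanned S'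
  | .leftEnd => .leftEnd
  | .cell s => .cell (f s)

theorem scan_map {S S' : Type} (f : S → S') (T : ℕ → S) (h : ℕ) :
    scan (fun n => f (T n)) h = (scan T h).map f := by
  cases h <;> rfl

/-! ### Rereading the valuation tape -/

/-- A counter, modulo `m`, of the blanks to the left of the scanned cell. A machine moving left does
not yet know whether the cell that it will scan is blank; in this case the flag is set and the count
includes that cell. -/
abbrev BlockCounter (m : ℕ) : Type := ZMod m × Bool

/-- The number of blanks in the scanned cell. -/
def Scanned.blanks {S : Type} : Scanned (Option S) → ℕ
  | .cell none => 1
  | _ => 0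

namespace BlockCounter

variable {m : ℕ} {S : Type}

/-- The number of blanks to the left of the scanned cell, modulo `m`. -/
def value (c : BlockCounter m) (v : Scanned (Option S)) : ZMod m :=
  if c.2 then c.1 - v.blanks else c.1

/-- The counter after a move of the head, if there were `c` blanks to the left of the previously
scanned cell. -/
def move (c : ZMod m) (v : Scanned (Option S)) : Dir → BlockCounter m
  | .left => (c, true)
  | .stay => (c, false)
  | .right => (c + v.blanks, false)

theorem value_move (T : ℕ → Option S) [DecidablePred (T · = none)] (h : ℕ) (d : Dir) :
    (move (Nat.count (T · = none) (h - 1) : ZMod m) (scan T h) d).value (scan T (d.shift h)) =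
      Nat.count (T · = none) (d.shift h - 1) := by
  have count_succ (n : ℕ) : (Nat.count (T · = none) (n + 1) : ZMod m) =
      Nat.count (T · = none) n + (scan T (n + 1)).blanks := by
    rw [Nat.count_succ, Nat.cast_add]
    obtain hn | ⟨s, hn⟩ := (T n).eq_none_or_eq_some <;> simp [scan, Scanned.blanks, hn]
  match d, h with
  | .stay, _ => rfl
  | .right, 0 => simp [value, move, scan, Scanned.blanks, Dir.shift]
  | .right, h + 1 => exact (count_succ h).symm
  | .left, 0 | .left, 1 => simp [value, move, scan, Scanned.blanks, Dir.shift]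
  | .left, h + 2 => exact sub_eq_of_eq_add (count_succ h)

end BlockCounter

namespace HPM

variable {H : HPM} {m : ℕ} [NeZero m] {g : ZMod m → Fin 10 → Fin 10} {e e' : Valuation}

/-- The machine that works as `H` does, but sees the digits in the block of `vᵢ` on the valuation
tape replaced according to `g i`. -/
def reread (H : HPM) (m : ℕ) [NeZero m] (g : ZMod m → Fin 10 → Fin 10) : HPM where
  State := H.State × BlockCounter m
  Aux := H.Aux
  finite_state :=
    have := H.finite_state
    have : Finite (ZMod m) := .of_fintype _
    inferInstance
  finite_aux := H.finite_aux
  start := (H.start, 0, false)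
  moveStates := Prod.fst ⁻¹' H.moveStates
  trans s v r w :=
    let i := s.2.value v
    let a := H.trans s.1 (v.map (Option.map (g i))) r w
    ⟨(a.state, BlockCounter.move i v a.valDir), a.write, a.valDir, a.runDir, a.workDir⟩

/-- Forgets the block counter. -/
def Config.ofReread (C : (H.reread m g).Config) : H.Config :=
  ⟨C.state.1, C.valHead, C.runHead, C.workHead, C.work, C.run⟩

theorem play_reread (h : ∀ i, decimalDigits (e' i) = (decimalDigits (e i)).map (g (i : ZMod m)))
    (β : ℕ → List Move) : (H.reread m g).play e β = H.play e' β := by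
  refine play_eq_of_simulation (fun C C' => C' = C.ofReread ∧
    C.state.2.value (scan (valTape e) C.valHead) =
      Nat.count (valTape e · = none) (C.valHead - 1)) ⟨rfl, ?_⟩ ?_ ?_ β
  · simp [HPM.init, HPM.reread, BlockCounter.value]
  · rintro C _ βs ⟨rfl, hcount⟩
    have hscan : (scan (valTape e) C.valHead).map
        (Option.map (g (C.state.2.value (scan (valTape e) C.valHead)))) =
        scan (valTape e') C.valHead := by
      rw [hcount]
      cases C.valHead with
      | zero => rfl
      | succ k => exact congrArg Scanned.cell (valTape_eq_map (g := fun i => g i) h k).symm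
    constructor
    · simp only [HPM.next, HPM.Config.ofReread, ← hscan]
      rfl
    · refine Eq.trans ?_ (BlockCounter.value_move (valTape e) C.valHead _)
      rw [← hcount]
      rfl
  · rintro C _ ⟨rfl, -⟩
    rfl

end HPM

/-! ### Enumeration of machines -/

instance : Finite Player :=
  .of_surjective (fun b : Bool => if b then .top else .bot) fun
    | .top => ⟨true, rfl⟩
    | .bot => ⟨false, rfl⟩

instance : Finite Dir :=
  .of_surjective ![.left, .stay, .right] fun
    | .left => ⟨0, rfl⟩
    | .stay => ⟨1, rfl⟩
    | .right => ⟨2, rfl⟩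

instance : Finite Key :=
  .of_surjective
    (Sum.elim Key.digit (Sum.elim Key.other fun b : Bool => if b then .dot else .spade)) fun
    | .digit d => ⟨.inl d, rfl⟩
    | .other i => ⟨.inr (.inl i), rfl⟩
    | .dot => ⟨.inr (.inr true), rfl⟩
    | .spade => ⟨.inr (.inr false), rfl⟩

instance {S : Type} [Finite S] : Finite (Scanned S) :=
  .of_surjective (fun o : Option S => o.elim .leftEnd .cell) fun
    | .leftEnd => ⟨none, rfl⟩
    | .cell s => ⟨some s, rfl⟩

instance {S A : Type} [Finite S] [Finite A] : Finite (Action S A) :=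
  .of_injective (fun a => (a.state, a.write, a.valDir, a.runDir, a.workDir)) fun
    | ⟨_, _, _, _, _⟩, ⟨_, _, _, _, _⟩, h => by simpa only [Action.mk.injEq, Prod.mk.injEq] using h

/-- The data of a machine with given states and auxiliary symbols: the start state, the move states
and the transition function. -/
abbrev Program (S A : Type) : Type :=
  S × Set S × (S → Scanned (Option (Fin 10)) → Scanned (Option (Player ⊕ Key)) →
    Scanned (Option (Key ⊕ A)) → Action S A)

/-- The machine with a given program. -/
abbrev Program.toHPM {S A : Type} [Finite S] [Finite A] (P : Program S A) : HPM where
  State := S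
  Aux := A
  finite_state := inferInstance
  finite_aux := inferInstance
  start := P.1
  moveStates := P.2.1
  trans := P.2.2

theorem writeAt_map {S S' : Type} (f : S → S') (T : ℕ → S) (s : S) (h : ℕ) :
    (fun n => f (writeAt T s h n)) = writeAt (fun n => f (T n)) (f s) h := by
  cases h with
  | zero => rfl
  | succ h => exact Function.comp_update f T h s

theorem leadingKeys_map {A A' : Type} (f : A → A') (l : List (Option (Key ⊕ A))) :
    leadingKeys (l.map (Option.map (Sum.map id f))) = leadingKeys l := by
  induction l with
  | nil => rfl
  | cons a l ih =>
    match a with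
    | none | some (.inr _) => rfl
    | some (.inl k) => exact congrArg (k :: ·) ih

namespace HPM

variable {H : HPM} {S A : Type} [Finite S] [Finite A] {σ : H.State ≃ S} {α : H.Aux ≃ A}

/-- The program of `H` after renaming its states and its auxiliary symbols. -/
def relabel (H : HPM) (σ : H.State ≃ S) (α : H.Aux ≃ A) : Program S A :=
  (σ H.start, σ.symm ⁻¹' H.moveStates, fun s v r w =>
    let a := H.trans (σ.symm s) v r (w.map (Option.map (Sum.map id α.symm)))
    ⟨σ a.state, a.write.map (Sum.map id α), a.valDir, a.runDir, a.workDir⟩)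

/-- Undoes the renaming of states and auxiliary symbols. -/
def Config.ofRelabel (C : (H.relabel σ α).toHPM.Config) : H.Config :=
  ⟨σ.symm C.state, C.valHead, C.runHead, C.workHead,
    fun n => (C.work n).map (Sum.map id α.symm), C.run⟩

theorem Config.move_ofRelabel (C : (H.relabel σ α).toHPM.Config) : C.ofRelabel.move = C.move := by
  refine Eq.trans ?_ (leadingKeys_map α.symm ((List.range (C.workHead - 1)).map C.work))
  rw [List.map_map]
  rfl

theorem play_relabel (e : Valuation) (β : ℕ → List Move) :
    (H.relabel σ α).toHPM.play e β = H.play e β := by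
  refine play_eq_of_simulation (fun C C' => C' = C.ofRelabel) ?_ ?_ ?_ β
  · exact congrArg (fun s => (⟨s, 0, 0, 0, fun _ => none, []⟩ : H.Config))
      (σ.symm_apply_apply _).symm
  · rintro C _ βs rfl
    simp only [HPM.next, Config.move_ofRelabel]
    have hwrite (o : Option (Key ⊕ H.Aux)) :
        (o.map (Sum.map id α)).map (Sum.map id α.symm) = o := by
      rw [Option.map_map, Sum.map_comp_map, α.symm_comp_self, Function.id_comp, Sum.map_id_id,
        Option.map_id, id]
    have hscan : scan C.ofRelabel.work C.ofRelabel.workHead =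
        (scan C.work C.workHead).map (Option.map (Sum.map id α.symm)) :=
      scan_map (Option.map (Sum.map id α.symm)) C.work C.workHead
    rw [hscan, Config.ofRelabel, Config.mk.injEq]
    refine ⟨(σ.symm_apply_apply _).symm, rfl, rfl, rfl, ?_, rfl⟩
    exact ((writeAt_map _ _ _ _).trans (congrArg (writeAt _ · _) (hwrite _))).symm
  · rintro C _ rfl
    rfl

theorem exists_enumeration :
    ∃ Hs : ℕ → HPM, ∀ H : HPM, ∃ k, ∀ e β, (Hs k).play e β = H.play e β := by
  have : Nonempty (Σ n a : ℕ, Program (Fin n) (Fin a)) :=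
    ⟨1, 0, 0, ∅, fun _ _ _ _ => ⟨0, none, .stay, .stay, .stay⟩⟩
  obtain ⟨P, hP⟩ := exists_surjective_nat (Σ n a : ℕ, Program (Fin n) (Fin a))
  let machine (P : Σ n a : ℕ, Program (Fin n) (Fin a)) : HPM := P.2.2.toHPM
  refine ⟨fun k => machine (P k), fun H => ?_⟩
  have := H.finite_state
  have := H.finite_aux
  obtain ⟨n, ⟨σ⟩⟩ := Finite.exists_equiv_fin H.State
  obtain ⟨a, ⟨α⟩⟩ := Finite.exists_equiv_fin H.Aux
  obtain ⟨k, hk⟩ := hP ⟨n, a, H.relabel σ α⟩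
  exact ⟨k, fun e β => (congrArg (fun P => (machine P).play e β) hk).trans (play_relabel e β)⟩

end HPM

/-! ### Marked valuations -/

theorem length_decimalDigits_ne_zero (c : ℕ) : (decimalDigits c).length ≠ 0 := by
  unfold decimalDigits
  split_ifs with hc
  · exact one_ne_zero
  · simpa using Nat.digits_ne_nil_iff_ne_zero.2 hc

/-- The number whose decimal numeral consists of `n` digits `d`. -/
def repdigit (d : Fin 10) (n : ℕ) : ℕ := Nat.ofDigits 10 (List.replicate n (d : ℕ))

theorem decimalDigits_repdigit {d : Fin 10} (hd : d ≠ 0) {n : ℕ} (hn : n ≠ 0) :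
    decimalDigits (repdigit d n) = List.replicate n d := by
  have hdigits : Nat.digits 10 (repdigit d n) = List.replicate n (d : ℕ) := by
    refine Nat.digits_ofDigits 10 (by norm_num) _ (fun l hl => ?_) fun h => ?_
    · rw [List.eq_of_mem_replicate hl]
      exact d.isLt
    · rw [List.getLast_replicate]
      exact Fin.val_ne_zero_iff.2 hd
  have hne : repdigit d n ≠ 0 := by
    rw [← Nat.digits_ne_nil_iff_ne_zero, hdigits]
    simpa using hn
  rw [decimalDigits, if_neg hne, hdigits]
  simp

theorem repdigit_mod_ten (d : Fin 10) {n : ℕ} (hn : n ≠ 0) : repdigit d n % 10 = d := by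
  obtain ⟨n, rfl⟩ := Nat.exists_eq_succ_of_ne_zero hn
  rw [repdigit, Nat.ofDigits_mod_eq_head!, List.replicate_succ, List.head!_cons,
    Nat.mod_eq_of_lt d.isLt]

/-- The least `j` such that the numeral of the value of the variable `N + 2 * j + 1` ends with the
digit `2`, the junk value being `0`. -/
noncomputable def marker (N : ℕ) (e : Valuation) : ℕ := sInf {j | e (N + 2 * j + 1) % 10 = 2}

theorem marker_congr {N : ℕ} {e e' : Valuation}
    (h : ∀ j, e (N + 2 * j + 1) = e' (N + 2 * j + 1)) : marker N e = marker N e' := by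
  simp only [marker, h]

/-- The digit that replaces `d` in the blocks of the variables with index `i` modulo
`N + 2 * k + 2`, which is periodic because a machine can count blocks only modulo a number. In the
first period, the variables from `N` on get numerals consisting of digits `1`, except the last one,
whose numeral consists of digits `2`. -/
def markDigit (N k : ℕ) (i : ZMod (N + 2 * k + 2)) (d : Fin 10) : Fin 10 :=
  if i.val < N then d else if i.val = N + 2 * k + 1 then 2 else 1

/-- A valuation with the marker `k` whose tape arises from that of `e` by replacing digits, and
which agrees with `e` on the first `N` variables. -/
def markValuation (N k : ℕ) (e : Valuation) : Valuation := fun i =>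
  if i % (N + 2 * k + 2) < N then e i
  else repdigit (if i % (N + 2 * k + 2) = N + 2 * k + 1 then 2 else 1) (decimalDigits (e i)).length

theorem decimalDigits_markValuation (N k : ℕ) (e : Valuation) (i : ℕ) :
    decimalDigits (markValuation N k e i) = (decimalDigits (e i)).map (markDigit N k i) := by
  have hlen := length_decimalDigits_ne_zero (e i)
  unfold markValuation markDigit
  rw [ZMod.val_natCast]
  split_ifs
  · exact (List.map_id' _).symm
  all_goals rw [decimalDigits_repdigit (by decide) hlen, List.map_const']

theorem markValuation_of_lt {N i : ℕ} (k : ℕ) (e : Valuation) (h : i < N) :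
    markValuation N k e i = e i := by
  rw [markValuation, Nat.mod_eq_of_lt (by lia), if_pos h]

theorem markValuation_mod_ten {N k i : ℕ} (e : Valuation) (hN : N ≤ i) (hi : i < N + 2 * k + 2) :
    markValuation N k e i % 10 = if i = N + 2 * k + 1 then 2 else 1 := by
  rw [markValuation, Nat.mod_eq_of_lt hi, if_neg hN.not_gt,
    repdigit_mod_ten _ (length_decimalDigits_ne_zero _)]
  split_ifs <;> rfl

theorem marker_markValuation (N k : ℕ) (e : Valuation) : marker N (markValuation N k e) = k := by
  refine IsLeast.csInf_eq ⟨?_, fun j hj => ?_⟩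
  · rw [Set.mem_ofPred_eq, markValuation_mod_ten e (by lia) (by lia), if_pos rfl]
  · by_contra hlt
    rw [Set.mem_ofPred_eq, markValuation_mod_ten e (by lia) (by lia), if_neg (by lia)] at hj
    exact absurd hj (by decide)

/-! ### The diagonal interpretation -/

/-- The elementary game won by `w e` at the valuation `e`. -/
noncomputable def Game.elementary (w : Valuation → Player) : Game :=
  Game.ofLegal (fun _ => {Stream'.Seq.nil}) (fun e _ => w e)
    (Game.trivial .top).legal_iff (Game.trivial .top).no_spade

namespace Interpretation

/-- The interpretation that induces the model `M k` at the valuations with the marker `k`. The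
attached variables avoid those that `marker N` inspects. -/
noncomputable def diagonal (N : ℕ) (M : ℕ → Model) : Interpretation where
  game p := Game.elementary fun e => M (marker N e) p fun i => e (N + 2 * i)
  elementary _ _ _ h := h
  vars _ i := N + 2 * i
  vars_injective _ _ _ h := Fin.ext (Nat.eq_of_mul_eq_mul_left two_pos (Nat.add_left_cancel h))

theorem diagonal_admissible {F : Formula} {N : ℕ} (hN : ∀ x, F.Occurs x → x < N) (M : ℕ → Model) :
    (diagonal N M).Admissible F := by
  rintro p x hx hvars ⟨e, e', heq, hne⟩
  have hmarker : marker N e = marker N e' :=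
    marker_congr fun j => heq _ (by have := hN x hx; grind)
  have hargs : (fun i : Fin p.arity => e (N + 2 * i)) = fun i : Fin p.arity => e' (N + 2 * i) :=
    funext fun i => heq _ (hvars i)
  have hagree : ((diagonal N M).game p).Agree e ((diagonal N M).game p) e' :=
    .ofLegal rfl (by simp only [hmarker, hargs])
  exact not_and_or.2 hne hagree

theorem model_diagonal (N : ℕ) (M : ℕ → Model) (e : Valuation) :
    (diagonal N M).model e = M (marker N e) := by
  ext p a
  let e' := Function.extend ((diagonal N M).vars p) a e
  have hmarker : marker N e' = marker N e := marker_congr fun j =>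
    Function.extend_apply' _ _ _ fun ⟨i, hi⟩ => by
      have hi : N + 2 * (i : ℕ) = N + 2 * j + 1 := hi
      lia
  have hargs : (fun i : Fin p.arity => e' (N + 2 * i)) = a :=
    funext fun i => ((diagonal N M).vars_injective p).extend_apply a e i
  calc (diagonal N M).model e p a = M (marker N e') p fun i => e' (N + 2 * i) := if_pos rfl
    _ = M (marker N e) p a := by rw [hmarker, hargs]

end Interpretation

theorem HPM.winsOn_reread_of_winsOn_diagonal {H : HPM} {I : Interpretation} {F : Formula}
    {N k : ℕ} {M : ℕ → Model} {e : Valuation} (hN : ∀ x, F.Occurs x → x < N)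
    (hI : I.Admissible F) (hM : M k = I.model e)
    (hH : H.WinsOn (markValuation N k e) ((Interpretation.diagonal N M).apply F)) :
    (H.reread (N + 2 * k + 2) (markDigit N k)).WinsOn e (I.apply F) := by
  have hagree : (I.apply F).Agree e ((Interpretation.diagonal N M).apply F) (markValuation N k e) :=
    hI.agree_apply (Interpretation.diagonal_admissible hN M)
      (by rw [Interpretation.model_diagonal, marker_markValuation, hM])
      fun x hx => (markValuation_of_lt k e (hN x hx)).symm
  rw [HPM.winsOn_iff] at hH ⊢
  intro β
  rw [hagree.2, HPM.play_reread (decimalDigits_markValuation N k e)]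
  exact hH β

end CoL

theorem theorem5p5 (F : CoL.Formula) : F.Valid ↔ F.UniformlyValid := by
  refine ⟨fun hF => ?_, fun ⟨H, hH⟩ I hI => ⟨H, hH I hI⟩⟩
  by_contra hnot
  obtain ⟨N, hN⟩ := F.exists_forall_occurs_lt
  obtain ⟨Hs, hHs⟩ := CoL.HPM.exists_enumeration
  have hlose (k : ℕ) : ∃ I : CoL.Interpretation, I.Admissible F ∧ ∃ e,
      ¬ ((Hs k).reread (N + 2 * k + 2) (CoL.markDigit N k)).WinsOn e (I.apply F) := by
    by_contra! hwin
    exact hnot ⟨_, hwin⟩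
  choose I hI e hIe using hlose
  let M (k : ℕ) : CoL.Model := (I k).model (e k)
  obtain ⟨H, hH⟩ := hF _ (CoL.Interpretation.diagonal_admissible hN M)
  obtain ⟨k, hk⟩ := hHs H
  have hwin : (Hs k).WinsOn (CoL.markValuation N k (e k))
      ((CoL.Interpretation.diagonal N M).apply F) := by
    simpa only [CoL.HPM.winsOn_iff, hk] using hH (CoL.markValuation N k (e k))
  exact hIe k (CoL.HPM.winsOn_reread_of_winsOn_diagonal hN (hI k) rfl hwin)
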